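/- For complex $a,q$ with $|q|<1$ let $(a;q)_k=\prod_{j=0}^{k-1}(1-aq^j)$ for $k\in\mathbb Z_{\ge 0}\cup\{\infty\}$, and let $$H(q)=\sum_{k=0}^\infty\frac{q^{k^2+k}}{(q;q)_k}.$$ Let $q\in\mathbb C$ with $|q|<1$, fix any fourth root $q^{1/4}$ of $q$, and put $q^{1/2}=(q^{1/4})^2$. Then the series defining $H(q)$ and all series below converge, and $$H(q)=\bigl(q^{1/2};q\bigr)_\infty\sum_{k=0}^\infty\frac{q^{k(3k+5)/4}}{\bigl(q^{1/2};q^{1/2}\bigr)_k\bigl(q^{1/2};q\bigr)_{k+2}},$$ $$H(q)=(-q;q)_\infty\sum_{k=0}^\infty\frac{(-1)^kq^{k(3k+2)}}{(q^4;q^4)_k(-q;q^2)_{k+1}},$$ $$H(q)=(-q;q)_\infty\sum_{k=0}^\infty\frac{(-1)^kq^{k(3k-2)}}{(q^4;q^4)_k(-q;q^2)_{k}}.$$ Moreover $H(q)=\dfrac1{(q^2;q^5)_\infty(q^3;q^5)_\infty}$, so that these become the product formulas $$\sum_{k=0}^\infty\frac{q^{k(3k+5)/4}}{\bigl(q^{1/2};q^{1/2}\bigr)_k\bigl(q^{1/2};q\bigr)_{k+2}}=\frac1{(q^{1/2};q)_\infty(q^2;q^5)_\infty(q^3;q^5)_\infty},$$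 $$\sum_{k=0}^\infty\frac{(-1)^kq^{k(3k+2)}}{(q^4;q^4)_k(-q;q^2)_{k+1}}=\sum_{k=0}^\infty\frac{(-1)^kq^{k(3k-2)}}{(q^4;q^4)_k(-q;q^2)_{k}}=\frac1{(-q;q)_\infty(q^2;q^5)_\infty(q^3;q^5)_\infty}.$$ -/

import Mathlib

/-- The finite `q`-shifted factorial `(a; q)_k = ∏_{j=0}^{k-1} (1 - a q^j)`. -/
noncomputable def qPoch (a q : ℂ) (k : ℕ) : ℂ :=
  ∏ j ∈ Finset.range k, (1 - a * q ^ j)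

/-- The infinite `q`-shifted factorial `(a; q)_∞ = ∏_{j=0}^∞ (1 - a q^j)`, for `|q| < 1`. -/
noncomputable def qPochInf (a q : ℂ) : ℂ :=
  ∏' j : ℕ, (1 - a * q ^ j)

/-- The product defining `(a; q)_∞` converges for `|q| < 1`. -/
theorem multipliable_qPochInf (a : ℂ) {q : ℂ} (hq : ‖q‖ < 1) :
    Multipliable (fun j : ℕ => 1 - a * q ^ j) := by
  have h : Summable (fun j : ℕ => ‖-(a * q ^ j)‖) := by
    simp only [norm_neg, norm_mul, norm_pow]
    exact (summable_geometric_of_lt_one (norm_nonneg q) hq).mul_left _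
  simpa only [sub_eq_add_neg] using multipliable_one_add_of_summable h

/-- `R(t; q) = ∑_{k ≥ 0} q^{k^2} t^k / (q; q)_k`. -/
noncomputable def rrR (t q : ℂ) : ℂ :=
  ∑' k : ℕ, q ^ (k ^ 2) * t ^ k / qPoch q q k

/-- The Rogers–Ramanujan function `H(q) = R(q; q)`. -/
noncomputable def rrH (q : ℂ) : ℂ := rrR q q

/-!
For a power series `F = ∑ Fₙ zⁿ`, multiplying `Fₙ` by `q ^ C(n, 2)` turns the factorization
`F = A(z) / (-cz; q)_∞` into a series with summands `q ^ C(j, 2) xʲ Aⱼ (cx qʲ; q)_∞`, because the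
power series of `1 / (-cz; q)_∞` becomes that of an infinite product. Up to rescaling `z`,
`R(t; q)` arises in this way from `F = (-z; q)_∞`. Writing `F = (z²; q²)_∞ / (z; q)_∞` gives the
series with `q ^ (k (3k + 2))`, and, with base `q = p²`, writing `F = (-z; p)_∞ / (-pz; p²)_∞`
gives the one with `q ^ (k (3k + 5) / 4)`. The series with `q ^ (k (3k - 2))` differs from the one
with `q ^ (k (3k + 2))` by a telescoping sum.

The same transformation applied to `F = 1` is Cauchy's identity
`∑ q ^ (n²) aⁿ (a q ^ (n + 1); q)_∞ / (q; q)_n = 1`, whose case `a = q ^ d` is the Durfee rectangle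
identity. Expanding a product of two infinite products along the diagonals of `ℕ × ℕ` then gives
the Jacobi triple product. The product formula for `H(q)` results from expanding `1 / (q; q)_k` by
a Bailey pair, which reduces it to the Durfee rectangle identity and the triple product.
-/

open Asymptotics Filter PowerSeries Topology
open Finset.HasAntidiagonal (antidiagonal sigmaAntidiagonalEquivProd)

section Sums

variable {E : Type*} [AddCommGroup E] [UniformSpace E] [IsUniformAddGroup E]

theorem hasSum_of_eq_add_telescope {f g u : ℕ → E} {s : E} (hg : HasSum g s)
    (hu : Summable u) (hu0 : u 0 = 0) (h : ∀ n, f n = g n + (u n - u (n + 1))) :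
    HasSum f s := by
  obtain ⟨U, hU⟩ := hu
  have hU' : HasSum (fun n => u (n + 1)) U := by simpa [hu0] using (hasSum_nat_add_iff' 1).2 hU
  rw [← add_zero s, ← sub_self U]
  exact (hg.add (hU.sub hU')).congr_fun h

theorem hasSum_fiber_of_hasSum_antidiagonal [CompleteSpace E] [T2Space E] {f : ℕ × ℕ → E}
    {g : ℕ → E} {s : E} (hf : Summable f)
    (hs : HasSum (fun n => ∑ x ∈ antidiagonal n, f x) s)
    (hg : ∀ j, HasSum (fun m => f (j, m)) (g j)) : HasSum g s := by
  have hdiag : HasSum (fun n => ∑ x ∈ antidiagonal n, f x) (∑' x, f x) :=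
    (sigmaAntidiagonalEquivProd.hasSum_iff.2 hf.hasSum).sigma fun n =>
      (antidiagonal n).hasSum f
  exact hs.unique hdiag ▸ hf.hasSum.prod_fiberwise hg

/-- The pairs `(m, n)` with `n ≤ m` (left summand) and with `m < n` (right summand), each
parametrized by the difference of the entries and the smaller entry. -/
def pairsByDifference : (ℕ × ℕ) ⊕ (ℕ × ℕ) → ℕ × ℕ :=
  Sum.elim (fun x => (x.2 + x.1, x.2)) fun x => (x.2, x.2 + (x.1 + 1))

theorem pairsByDifference_bijective : Function.Bijective pairsByDifference := by
  constructor
  · rintro (⟨a, b⟩ | ⟨a, b⟩) (⟨c, d⟩ | ⟨c, d⟩) h <;>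
      simp only [pairsByDifference, Sum.elim_inl, Sum.elim_inr, Prod.mk.injEq, Sum.inl.injEq,
        Sum.inr.injEq, reduceCtorEq] at h ⊢ <;> omega
  · rintro ⟨m, n⟩
    rcases le_or_gt n m with h | h
    · exact ⟨Sum.inl (m - n, n), by simp [pairsByDifference, h]⟩
    · exact ⟨Sum.inr (n - m - 1, m), by simp [pairsByDifference]; omega⟩

theorem hasSum_differences [CompleteSpace E] [T2Space E] {f : ℕ × ℕ → E} {g h : ℕ → E} {s : E}
    (hf : HasSum f s) (hg : ∀ d, HasSum (fun n => f (n + d, n)) (g d))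
    (hh : ∀ d, HasSum (fun n => f (n, n + (d + 1))) (h d)) :
    HasSum (fun d => g d + h d) s := by
  let e := Equiv.ofBijective _ pairsByDifference_bijective
  have hfe : HasSum (f ∘ e) s := e.hasSum_iff.2 hf
  have hle := (hfe.summable.comp_injective Sum.inl_injective).hasSum
  have hgt := (hfe.summable.comp_injective Sum.inr_injective).hasSum
  exact (hle.sum hgt).unique hfe ▸
    (hle.prod_fiberwise hg).add (hgt.prod_fiberwise hh)

end Sums

section QPochhammer

theorem qPoch_zero (a q : ℂ) : qPoch a q 0 = 1 := by simp [qPoch]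

theorem qPoch_succ (a q : ℂ) (k : ℕ) :
    qPoch a q (k + 1) = qPoch a q k * (1 - a * q ^ k) :=
  Finset.prod_range_succ _ _

theorem qPoch_add (a q : ℂ) (k n : ℕ) :
    qPoch a q (k + n) = qPoch a q k * qPoch (a * q ^ k) q n := by
  simp [qPoch, Finset.prod_range_add, pow_add, mul_assoc]

theorem one_sub_mul_pow_ne_zero {R : Type*} [Ring R] {q : R} (hq : ∀ n, q ^ (n + 1) ≠ 1) (n : ℕ) :
    1 - q * q ^ n ≠ 0 :=
  pow_succ' q n ▸ sub_ne_zero.2 (hq n).symm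

theorem qPoch_self_ne_zero {q : ℂ} (hq : ∀ n, q ^ (n + 1) ≠ 1) (n : ℕ) : qPoch q q n ≠ 0 :=
  Finset.prod_ne_zero_iff.2 fun j _ => one_sub_mul_pow_ne_zero hq j

theorem pow_succ_ne_one_of_norm_lt_one {K : Type*} [NormedDivisionRing K] {q : K} (hq : ‖q‖ < 1)
    (n : ℕ) : q ^ (n + 1) ≠ 1 :=
  fun h => (pow_lt_one₀ (norm_nonneg q) hq n.succ_ne_zero).ne (by rw [← norm_pow, h, norm_one])

theorem pow_pow_succ_ne_one {M : Type*} [Monoid M] {q : M} (hq : ∀ n, q ^ (n + 1) ≠ 1) {m : ℕ}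
    (hm : m ≠ 0) (n : ℕ) : (q ^ m) ^ (n + 1) ≠ 1 := by
  obtain ⟨l, hl⟩ := Nat.exists_eq_succ_of_ne_zero (mul_ne_zero hm n.succ_ne_zero)
  rw [← pow_mul, hl]
  exact hq l

theorem norm_pow_lt_one {K : Type*} [NormedDivisionRing K] {q : K} (hq : ‖q‖ < 1) {n : ℕ}
    (hn : n ≠ 0) : ‖q ^ n‖ < 1 :=
  norm_pow q n ▸ pow_lt_one₀ (norm_nonneg q) hq hn

variable {a q : ℂ}

theorem tendsto_qPoch (a : ℂ) (hq : ‖q‖ < 1) :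
    Tendsto (qPoch a q) atTop (𝓝 (qPochInf a q)) :=
  (multipliable_qPochInf a hq).hasProd.tendsto_prod_nat

theorem qPoch_mul_qPochInf (a : ℂ) (hq : ‖q‖ < 1) (k : ℕ) :
    qPoch a q k * qPochInf (a * q ^ k) q = qPochInf a q := by
  have h := (tendsto_add_atTop_iff_nat k).2 (tendsto_qPoch a hq)
  simp only [add_comm _ k, qPoch_add] at h
  exact tendsto_nhds_unique ((tendsto_qPoch _ hq).const_mul _) h

theorem qPochInf_ne_zero (ha : ‖a‖ < 1) (hq : ‖q‖ < 1) : qPochInf a q ≠ 0 := by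
  have hnorm (j : ℕ) : ‖a * q ^ j‖ ≤ ‖a‖ * ‖q‖ ^ j := by rw [norm_mul, norm_pow]
  have hsum : Summable fun j : ℕ => ‖-(a * q ^ j)‖ := by
    simpa using (summable_geometric_of_lt_one (norm_nonneg q) hq).mul_left ‖a‖
  have hfactor (j : ℕ) : 1 + -(a * q ^ j) ≠ 0 := by
    rw [← sub_eq_add_neg, sub_ne_zero]
    intro h
    have hle := (hnorm j).trans (mul_le_of_le_one_right (norm_nonneg a)
      (pow_le_one₀ (norm_nonneg q) hq.le))
    rw [← h, norm_one] at hle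
    exact hle.not_gt ha
  simpa only [qPochInf, sub_eq_add_neg] using tprod_one_add_ne_zero_of_summable hfactor hsum

theorem qPoch_ne_zero (ha : ‖a‖ < 1) (hq : ‖q‖ < 1) (n : ℕ) : qPoch a q n ≠ 0 :=
  left_ne_zero_of_mul (qPoch_mul_qPochInf a hq n ▸ qPochInf_ne_zero ha hq)

theorem tendsto_inv_qPoch (ha : ‖a‖ < 1) (hq : ‖q‖ < 1) :
    Tendsto (fun n => (qPoch a q n)⁻¹) atTop (𝓝 (qPochInf a q)⁻¹) :=
  (tendsto_qPoch a hq).inv₀ (qPochInf_ne_zero ha hq)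

end QPochhammer

section ThetaDecay

theorem choose_two_succ (k : ℕ) : (k + 1).choose 2 = k.choose 2 + k := by
  rw [Nat.choose_succ_succ' k 1, Nat.choose_one_right, add_comm]

theorem choose_two_add (m n : ℕ) :
    (m + n).choose 2 = m.choose 2 + n.choose 2 + m * n := by
  induction n with
  | zero => simp
  | succ n ih => rw [← add_assoc, choose_two_succ, choose_two_succ, ih]; ring

theorem sq_eq_choose_two (k : ℕ) : k ^ 2 = 2 * k.choose 2 + k := by
  induction k with
  | zero => rfl
  | succ k ih => rw [choose_two_succ, add_sq, ih]; ring

variable {K : Type*} [NormedField K] {q : K}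

theorem summable_norm_pow_choose_two_mul_pow (hq : ‖q‖ < 1) (x : K) :
    Summable fun n : ℕ => ‖q ^ n.choose 2 * x ^ n‖ := by
  have hratio : Tendsto (fun n : ℕ => ‖x‖ * ‖q‖ ^ n) atTop (𝓝 0) := by
    simpa using (tendsto_pow_atTop_nhds_zero_of_lt_one (norm_nonneg q) hq).const_mul ‖x‖
  refine summable_of_ratio_norm_eventually_le (r := 1 / 2) (by norm_num) ?_
  filter_upwards [hratio.eventually_le_const (show (0 : ℝ) < 1 / 2 by norm_num)] with n hn
  have hsucc : q ^ (n + 1).choose 2 * x ^ (n + 1) = x * q ^ n * (q ^ n.choose 2 * x ^ n) := by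
    rw [choose_two_succ]; ring
  rw [norm_norm, norm_norm, hsucc, norm_mul, norm_mul x, norm_pow q]
  exact mul_le_mul_of_nonneg_right hn (norm_nonneg _)

theorem isBigO_one_of_summable_norm {E : Type*} [SeminormedAddCommGroup E] {b : ℕ → E}
    (hb : Summable fun n => ‖b n‖) :
    b =O[atTop] fun _ => (1 : ℝ) :=
  (hb.tendsto_atTop_zero.isBigO_one ℝ).of_norm_left

theorem summable_norm_pow_choose_two_mul (hq : ‖q‖ < 1) (x : K) {b : ℕ → K}
    (hb : b =O[atTop] fun _ => (1 : ℝ)) :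
    Summable fun n : ℕ => ‖q ^ n.choose 2 * x ^ n * b n‖ :=
  summable_of_isBigO_nat (summable_norm_pow_choose_two_mul_pow hq x) <| by
    simpa only [mul_one] using ((isBigO_refl _ atTop).norm_right.mul hb).norm_left

end ThetaDecay

section EulerSeries

theorem eq_of_eq_mul_rescale {R : Type*} [CommRing R] [IsDomain R] {q : R}
    (hq : ∀ n, q ^ (n + 1) ≠ 1) {A F G : R⟦X⟧} (hA : constantCoeff A = 1)
    (hF : F = A * rescale q F) (hG : G = A * rescale q G)
    (h0 : constantCoeff F = constantCoeff G) : F = G := by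
  have hrec {P : R⟦X⟧} (hP : P = A * rescale q P) (n : ℕ) : (1 - q ^ n) * coeff n P =
      ∑ x ∈ (antidiagonal n).erase (0, n), coeff x.1 A * (q ^ x.2 * coeff x.2 P) := by
    have h := congrArg (coeff n) hP
    rw [coeff_mul, ← Finset.add_sum_erase _ _ (show (0, n) ∈ antidiagonal n by simp)] at h
    simp only [coeff_zero_eq_constantCoeff_apply, hA, coeff_rescale, one_mul] at h
    linear_combination h
  ext n
  induction n using Nat.strong_induction_on with
  | _ n ih =>
    obtain rfl | ⟨m, rfl⟩ : n = 0 ∨ ∃ m, n = m + 1 := by cases n <;> simp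
    · simpa using h0
    refine mul_left_cancel₀ (sub_ne_zero.2 (hq m).symm) ?_
    rw [hrec hF, hrec hG]
    refine Finset.sum_congr rfl fun x hx => ?_
    have hlt : x.2 < m + 1 := by
      obtain ⟨hne, hsum⟩ := Finset.mem_erase.1 hx
      have := Finset.HasAntidiagonal.mem_antidiagonal.1 hsum
      contrapose! hne
      exact Prod.ext (by simp; omega) (by simp; omega)
    rw [ih x.2 hlt]

theorem constantCoeff_rescale {R : Type*} [CommSemiring R] (a : R) (F : R⟦X⟧) :
    constantCoeff (rescale a F) = constantCoeff F := by
  rw [← coeff_zero_eq_constantCoeff_apply, coeff_rescale, pow_zero, one_mul,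
    coeff_zero_eq_constantCoeff_apply]

theorem rescale_expand {R : Type*} [CommRing R] (a : R) {p : ℕ} (hp : p ≠ 0) (F : R⟦X⟧) :
    rescale a (expand p hp F) = expand p hp (rescale (a ^ p) F) := by
  ext n
  by_cases hn : p ∣ n
  · obtain ⟨k, rfl⟩ := hn
    simp [coeff_rescale, coeff_expand_mul, pow_mul]
  · simp [coeff_rescale, coeff_expand_of_not_dvd _ _ _ hn]

/-- The generating series `∑ q^{n(n-1)/2} zⁿ / (q; q)ₙ`, the formal counterpart of the infinite
product `(-z; q)_∞`. -/
noncomputable def eulerSeries (q : ℂ) : ℂ⟦X⟧ :=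
  PowerSeries.mk fun n => q ^ n.choose 2 / qPoch q q n

theorem coeff_eulerSeries (q : ℂ) (n : ℕ) :
    coeff n (eulerSeries q) = q ^ n.choose 2 / qPoch q q n :=
  coeff_mk _ _

theorem constantCoeff_eulerSeries (q : ℂ) : constantCoeff (eulerSeries q) = 1 := by
  rw [← coeff_zero_eq_constantCoeff_apply, coeff_eulerSeries, qPoch_zero, Nat.choose_zero_succ,
    pow_zero, div_one]

variable {q : ℂ}

theorem one_sub_pow_succ_mul_coeff_eulerSeries (hq : ∀ n, q ^ (n + 1) ≠ 1) (n : ℕ) :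
    (1 - q ^ (n + 1)) * coeff (n + 1) (eulerSeries q) = q ^ n * coeff n (eulerSeries q) := by
  have hn := qPoch_self_ne_zero hq n
  have hfactor := one_sub_mul_pow_ne_zero hq n
  rw [coeff_eulerSeries, coeff_eulerSeries, choose_two_succ, qPoch_succ]
  field_simp
  ring

theorem eulerSeries_eq_mul_rescale (hq : ∀ n, q ^ (n + 1) ≠ 1) :
    eulerSeries q = (1 + X) * rescale q (eulerSeries q) := by
  ext n
  cases n with
  | zero => simp [constantCoeff_rescale]
  | succ n =>
    rw [one_add_mul, map_add, coeff_succ_X_mul, coeff_rescale, coeff_rescale]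
    linear_combination one_sub_pow_succ_mul_coeff_eulerSeries hq n

theorem eulerSeries_mul_mk_inv (hq : ∀ n, q ^ (n + 1) ≠ 1) :
    eulerSeries q * PowerSeries.mk (fun n => (-1) ^ n / qPoch q q n) = 1 := by
  set B : ℂ⟦X⟧ := PowerSeries.mk fun n => (-1) ^ n / qPoch q q n with hB
  have hB' : (1 + X) * B = rescale q B := by
    ext n
    cases n with
    | zero => simp
    | succ n =>
      have hn := qPoch_self_ne_zero hq n
      have hfactor := one_sub_mul_pow_ne_zero hq n
      rw [one_add_mul, map_add, coeff_succ_X_mul, coeff_rescale, hB, coeff_mk, coeff_mk,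
        qPoch_succ]
      field_simp
      ring
  refine eq_of_eq_mul_rescale hq (A := 1) (map_one _) ?_ (by simp) ?_
  · rw [one_mul, map_mul, ← hB', ← mul_assoc, mul_comm (rescale q _),
      ← eulerSeries_eq_mul_rescale hq]
  · simp [hB, constantCoeff_eulerSeries, constantCoeff_mk, qPoch_zero]

theorem eulerSeries_eq_mul (hq : ∀ n, q ^ (n + 1) ≠ 1) :
    eulerSeries q = eulerSeries (q ^ 2) * rescale q (eulerSeries (q ^ 2)) := by
  have hq2 := pow_pow_succ_ne_one hq two_ne_zero
  refine eq_of_eq_mul_rescale hq (A := 1 + X) (by simp) (eulerSeries_eq_mul_rescale hq) ?_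
    (by simp [constantCoeff_rescale, constantCoeff_eulerSeries])
  have h := eulerSeries_eq_mul_rescale hq2
  rw [map_mul, rescale_rescale, ← sq]
  linear_combination rescale q (eulerSeries (q ^ 2)) * h

theorem eulerSeries_mul_rescale_neg_one (hq : ∀ n, q ^ (n + 1) ≠ 1) :
    eulerSeries q * rescale (-1) (eulerSeries q) =
      expand 2 two_ne_zero (rescale (-1) (eulerSeries (q ^ 2))) := by
  have hq2 := pow_pow_succ_ne_one hq two_ne_zero
  refine eq_of_eq_mul_rescale hq (A := 1 - X ^ 2) (by simp) ?_ ?_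
    (by simp [constantCoeff_rescale, constantCoeff_eulerSeries])
  · have h := eulerSeries_eq_mul_rescale hq
    have h' := congrArg (rescale (-1)) h
    simp only [map_mul, map_add, map_one, rescale_X, rescale_rescale, mul_neg_one, neg_one_mul,
      map_neg] at h' ⊢
    linear_combination rescale (-1) (eulerSeries q) * h + (1 + X) * rescale q (eulerSeries q) * h'
  · have h := congrArg (expand 2 two_ne_zero)
      (congrArg (rescale (-1)) (eulerSeries_eq_mul_rescale hq2))
    simp only [map_mul, map_add, map_one, rescale_X, rescale_rescale, expand_X, rescale_expand,
      map_neg, neg_one_mul, mul_neg_one] at h ⊢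
    linear_combination h

end EulerSeries

section Evaluation

variable {q : ℂ}

theorem summable_norm_eulerSeries (hq : ‖q‖ < 1) (y : ℂ) :
    Summable fun n => ‖coeff n (eulerSeries q) * y ^ n‖ := by
  refine (summable_norm_pow_choose_two_mul hq y
    ((tendsto_inv_qPoch hq hq).isBigO_one ℝ)).congr fun n => ?_
  rw [coeff_eulerSeries]
  congr 1
  ring

theorem norm_mul_mul_pow_pow_le {K : Type*} [NormedField K] {q : K} (hq : ‖q‖ < 1) (b y : K)
    (N n : ℕ) : ‖b * (y * q ^ N) ^ n‖ ≤ ‖b * y ^ n‖ := by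
  rw [mul_pow, ← mul_assoc, norm_mul, ← pow_mul, norm_pow q]
  exact mul_le_of_le_one_right (norm_nonneg _) (pow_le_one₀ (norm_nonneg q) hq.le)

theorem tsum_eulerSeries_eq_mul (hq : ‖q‖ < 1) (y : ℂ) :
    ∑' n, coeff n (eulerSeries q) * y ^ n =
      (1 + y) * ∑' n, coeff n (eulerSeries q) * (y * q) ^ n := by
  have hy := (summable_norm_eulerSeries hq y).of_norm
  have hyq := (summable_norm_eulerSeries hq (y * q)).of_norm
  have hu : Summable fun n => (1 - q ^ n) * (coeff n (eulerSeries q) * y ^ n) :=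
    (hy.sub hyq).congr fun n => by ring
  refine (hasSum_of_eq_add_telescope (hyq.hasSum.mul_left (1 + y)) hu (by simp) fun n => ?_).tsum_eq
  linear_combination y ^ (n + 1) *
    one_sub_pow_succ_mul_coeff_eulerSeries (pow_succ_ne_one_of_norm_lt_one hq) n

theorem hasSum_eulerSeries (hq : ‖q‖ < 1) (a : ℂ) :
    HasSum (fun n => coeff n (eulerSeries q) * (-a) ^ n) (qPochInf a q) := by
  set E : ℂ → ℂ := fun y => ∑' n, coeff n (eulerSeries q) * y ^ n
  have hiter (N : ℕ) : E (-a) = qPoch a q N * E (-a * q ^ N) := by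
    induction N with
    | zero => simp [qPoch_zero]
    | succ N ih =>
      have hstep : E (-a * q ^ N) = (1 + -a * q ^ N) * E (-a * q ^ N * q) :=
        tsum_eulerSeries_eq_mul hq _
      rw [ih, hstep, qPoch_succ, pow_succ, ← mul_assoc (-a)]
      ring
  have hlim : Tendsto (fun N : ℕ => E (-a * q ^ N)) atTop (𝓝 1) := by
    have hterm (n : ℕ) : Tendsto (fun N : ℕ => coeff n (eulerSeries q) * (-a * q ^ N) ^ n) atTop
        (𝓝 (coeff n (eulerSeries q) * (-a * 0) ^ n)) :=
      (((tendsto_pow_atTop_nhds_zero_of_norm_lt_one hq).const_mul (-a)).pow n).const_mul _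
    have hone : ∑' n, coeff n (eulerSeries q) * (-a * 0) ^ n = 1 := by
      rw [tsum_eq_single 0 fun n hn => by simp [hn]]
      simp [constantCoeff_eulerSeries]
    exact hone ▸ tendsto_tsum_of_dominated_convergence (summable_norm_eulerSeries hq (-a)) hterm
      (Eventually.of_forall fun N n => norm_mul_mul_pow_pow_le hq _ (-a) N n)
  have hval : E (-a) = qPochInf a q := tendsto_nhds_unique
    (tendsto_const_nhds.congr hiter) (mul_one (qPochInf a q) ▸ (tendsto_qPoch a hq).mul hlim)
  exact hval ▸ (summable_norm_eulerSeries hq (-a)).of_norm.hasSum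

theorem summable_norm_coeff_eulerSeries (hq : ‖q‖ < 1) :
    Summable fun n => ‖coeff n (eulerSeries q)‖ := by
  simpa only [one_pow, mul_one] using summable_norm_eulerSeries hq 1

theorem summable_norm_coeff_mul {R : Type*} [NormedCommRing R] {F G : R⟦X⟧}
    (hF : Summable fun n => ‖coeff n F‖) (hG : Summable fun n => ‖coeff n G‖) :
    Summable fun n => ‖coeff n (F * G)‖ := by
  simpa only [coeff_mul] using summable_norm_sum_mul_antidiagonal_of_summable_norm hF hG

theorem summable_norm_coeff_rescale_eulerSeries (hq : ‖q‖ < 1) (c : ℂ) :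
    Summable fun n => ‖coeff n (rescale c (eulerSeries q))‖ := by
  simpa only [coeff_rescale, mul_comm] using summable_norm_eulerSeries hq c

theorem sum_antidiagonal_coeff_mul_rescale (hq : ∀ n, q ^ (n + 1) ≠ 1) (F : ℂ⟦X⟧) (c : ℂ) (n : ℕ) :
    ∑ x ∈ antidiagonal n,
      coeff x.1 (F * rescale c (eulerSeries q)) * ((-c) ^ x.2 / qPoch q q x.2) = coeff n F := by
  have hinv := congrArg (rescale c) (eulerSeries_mul_mk_inv hq)
  rw [map_mul, map_one, rescale_mk] at hinv
  calc _ = coeff n (F * rescale c (eulerSeries q) *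
        PowerSeries.mk fun n => c ^ n * ((-1) ^ n / qPoch q q n)) := by
        simp only [coeff_mul _ (_ * _), coeff_mk, neg_pow c]
        exact Finset.sum_congr rfl fun x _ => by ring
    _ = coeff n F := by rw [mul_assoc, hinv, mul_one]

theorem sum_antidiagonal_pow_choose_two (hq : ∀ n, q ^ (n + 1) ≠ 1) (F : ℂ⟦X⟧) (c x : ℂ)
    (n : ℕ) :
    ∑ p ∈ antidiagonal n,
      q ^ p.1.choose 2 * x ^ p.1 * coeff p.1 (F * rescale c (eulerSeries q)) *
        (coeff p.2 (eulerSeries q) * (-(c * x * q ^ p.1)) ^ p.2) =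
    q ^ n.choose 2 * x ^ n * coeff n F := by
  rw [← sum_antidiagonal_coeff_mul_rescale hq F c, Finset.mul_sum]
  refine Finset.sum_congr rfl fun p hp => ?_
  rw [← Finset.HasAntidiagonal.mem_antidiagonal.1 hp, choose_two_add, coeff_eulerSeries]
  ring

/- Since `C(j + m, 2) = C(j, 2) + C(m, 2) + jm`, inserting `q ^ C(n, 2)` into the Cauchy product
`F = A * (eulerSeries)⁻¹` lets the inner sum over `m` collapse to an infinite product. -/
theorem hasSum_pow_choose_two_mul_qPochInf (hq : ‖q‖ < 1) (c x : ℂ) {F : ℂ⟦X⟧}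
    (hF : Summable fun n => ‖coeff n F‖) :
    HasSum (fun j => q ^ j.choose 2 * x ^ j * coeff j (F * rescale c (eulerSeries q)) *
      qPochInf (c * x * q ^ j) q) (∑' n, q ^ n.choose 2 * x ^ n * coeff n F) := by
  set A := F * rescale c (eulerSeries q) with hA
  have hA1 : Summable fun n => ‖coeff n A‖ :=
    summable_norm_coeff_mul hF (summable_norm_coeff_rescale_eulerSeries hq c)
  set f : ℕ × ℕ → ℂ := fun p => q ^ p.1.choose 2 * x ^ p.1 * coeff p.1 A *
    (coeff p.2 (eulerSeries q) * (-(c * x * q ^ p.1)) ^ p.2) with hf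
  have hrow (j : ℕ) : HasSum (fun m => f (j, m))
      (q ^ j.choose 2 * x ^ j * coeff j A * qPochInf (c * x * q ^ j) q) :=
    (hasSum_eulerSeries hq (c * x * q ^ j)).mul_left (q ^ j.choose 2 * x ^ j * coeff j A)
  have hsummable : Summable f := by
    refine .of_norm_bounded ((summable_norm_pow_choose_two_mul hq x
      (isBigO_one_of_summable_norm hA1)).mul_of_nonneg
      (summable_norm_eulerSeries hq (-(c * x))) (fun _ => norm_nonneg _) fun _ => norm_nonneg _)
      fun p => ?_
    rw [norm_mul]
    refine mul_le_mul_of_nonneg_left ?_ (norm_nonneg _)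
    rw [neg_mul_eq_neg_mul]
    exact norm_mul_mul_pow_pow_le hq _ _ _ _
  refine hasSum_fiber_of_hasSum_antidiagonal hsummable ?_ hrow
  simpa only [hf, hA, sum_antidiagonal_pow_choose_two (pow_succ_ne_one_of_norm_lt_one hq)]
    using (summable_norm_pow_choose_two_mul hq x (isBigO_one_of_summable_norm hF)).of_norm.hasSum

end Evaluation

section Transformations

variable {q : ℂ}

theorem rrR_summand_eq (t q : ℂ) (k : ℕ) :
    q ^ (k ^ 2) * t ^ k / qPoch q q k =
      q ^ k.choose 2 * (t * q) ^ k * coeff k (eulerSeries q) := by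
  rw [sq_eq_choose_two, coeff_eulerSeries]
  ring

theorem rrR_eq_tsum (t q : ℂ) :
    rrR t q = ∑' k, q ^ k.choose 2 * (t * q) ^ k * coeff k (eulerSeries q) :=
  tsum_congr (rrR_summand_eq t q)

theorem summable_norm_rrR (hq : ‖q‖ < 1) (t : ℂ) :
    Summable fun k : ℕ => ‖q ^ (k ^ 2) * t ^ k / qPoch q q k‖ := by
  simpa only [rrR_summand_eq] using summable_norm_pow_choose_two_mul hq (t * q)
    (isBigO_one_of_summable_norm (summable_norm_coeff_eulerSeries hq))

theorem hasSum_rrR_even (hq : ‖q‖ < 1) (t : ℂ) :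
    HasSum (fun k : ℕ => (-1) ^ k * q ^ (3 * k ^ 2) * t ^ (2 * k) / qPoch (q ^ 2) (q ^ 2) k *
      qPochInf (-(t * q ^ (2 * k + 1))) q) (rrR t q) := by
  have h := hasSum_pow_choose_two_mul_qPochInf hq (-1) (t * q) (summable_norm_coeff_eulerSeries hq)
  rw [← rrR_eq_tsum, eulerSeries_mul_rescale_neg_one (pow_succ_ne_one_of_norm_lt_one hq)] at h
  refine ((Function.Injective.hasSum_iff (mul_right_injective₀ (two_ne_zero' ℕ)) fun j hj => ?_).2
    h).congr_fun fun k => ?_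
  · rw [coeff_expand_of_not_dvd _ _ _ fun ⟨k, hk⟩ => hj ⟨k, hk.symm⟩, mul_zero, zero_mul]
  · rw [Function.comp_apply, coeff_expand_mul, coeff_rescale, coeff_eulerSeries, sq_eq_choose_two,
      two_mul k, choose_two_add, ← sq, sq_eq_choose_two]
    ring_nf

theorem hasSum_rrR_sq {p : ℂ} (hp : ‖p‖ < 1) (t : ℂ) :
    HasSum (fun k : ℕ => p ^ (3 * k.choose 2 + 2 * k) * t ^ k / qPoch p p k *
      qPochInf (t * p ^ (2 * k + 3)) (p ^ 2)) (rrR t (p ^ 2)) := by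
  have hp2 := norm_pow_lt_one hp two_ne_zero
  have h := hasSum_pow_choose_two_mul_qPochInf hp2 p (t * p ^ 2)
    (summable_norm_coeff_eulerSeries hp2)
  rw [← rrR_eq_tsum, ← eulerSeries_eq_mul (pow_succ_ne_one_of_norm_lt_one hp)] at h
  refine h.congr_fun fun k => ?_
  rw [coeff_eulerSeries]
  ring_nf

theorem hasSum_cauchy (hq : ‖q‖ < 1) (a : ℂ) :
    HasSum (fun n : ℕ => q ^ (n ^ 2) * a ^ n / qPoch q q n * qPochInf (a * q ^ (n + 1)) q) 1 := by
  have hone : Summable fun n => ‖coeff n (1 : ℂ⟦X⟧)‖ :=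
    summable_of_ne_finset_zero (s := {0}) fun n hn => by
      simp [coeff_one, Finset.notMem_singleton.1 hn]
  have h := hasSum_pow_choose_two_mul_qPochInf hq 1 (a * q) hone
  rw [tsum_eq_single 0 fun n hn => by rw [coeff_one, if_neg hn, mul_zero]] at h
  rw [Nat.choose_zero_succ, pow_zero, pow_zero, coeff_zero_one, mul_one, mul_one] at h
  refine h.congr_fun fun n => ?_
  rw [rescale_one, RingHom.id_apply, one_mul, one_mul, ← rrR_summand_eq, pow_succ' q, mul_assoc a]

theorem hasSum_durfee (hq : ‖q‖ < 1) (d : ℕ) :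
    HasSum (fun n : ℕ => q ^ (n ^ 2 + n * d) / (qPoch q q n * qPoch q q (n + d)))
      (1 / qPochInf q q) := by
  refine ((hasSum_cauchy hq (q ^ d)).div_const (qPochInf q q)).congr_fun fun n => ?_
  have hne := qPochInf_ne_zero hq hq
  have htail := qPoch_mul_qPochInf q hq (n + d)
  rw [← htail] at hne
  have hpoch := left_ne_zero_of_mul hne
  have hinf := right_ne_zero_of_mul hne
  rw [show q ^ d * q ^ (n + 1) = q * q ^ (n + d) by ring, ← htail]
  field_simp
  ring

theorem coeff_eulerSeries_add_mul (q : ℂ) (n d : ℕ) :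
    coeff (n + d) (eulerSeries q) * coeff n (eulerSeries q) * q ^ n =
      q ^ d.choose 2 * (q ^ (n ^ 2 + n * d) / (qPoch q q n * qPoch q q (n + d))) := by
  rw [coeff_eulerSeries, coeff_eulerSeries, choose_two_add, sq_eq_choose_two]
  ring

theorem jacobi_triple_product {x y : ℂ} (hxy : ‖x * y‖ < 1) :
    HasSum (fun d : ℕ => (x * y) ^ d.choose 2 * (-x) ^ d +
      (x * y) ^ (d + 1).choose 2 * (-y) ^ (d + 1))
      (qPochInf (x * y) (x * y) * (qPochInf x (x * y) * qPochInf y (x * y))) := by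
  have hne := qPochInf_ne_zero hxy hxy
  have hprod := (hasSum_eulerSeries hxy x).mul (hasSum_eulerSeries hxy y)
    ((summable_norm_eulerSeries hxy (-x)).mul_norm (summable_norm_eulerSeries hxy (-y))).of_norm
  set c : ℕ → ℂ := fun n => coeff n (eulerSeries (x * y))
  have hcoeff (n d : ℕ) : c (n + d) * c n * ((-x) ^ n * (-y) ^ n) = (x * y) ^ d.choose 2 *
      ((x * y) ^ (n ^ 2 + n * d) / (qPoch (x * y) (x * y) n * qPoch (x * y) (x * y) (n + d))) := by
    rw [← mul_pow, neg_mul_neg]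
    exact coeff_eulerSeries_add_mul (x * y) n d
  have hle (d : ℕ) := ((hasSum_durfee hxy d).mul_left ((x * y) ^ d.choose 2 * (-x) ^ d)).congr_fun
    (g := fun n => c (n + d) * (-x) ^ (n + d) * (c n * (-y) ^ n))
    fun n => by linear_combination (-x) ^ d * hcoeff n d
  have hgt (d : ℕ) := ((hasSum_durfee hxy (d + 1)).mul_left
    ((x * y) ^ (d + 1).choose 2 * (-y) ^ (d + 1))).congr_fun
    (g := fun n => c n * (-x) ^ n * (c (n + (d + 1)) * (-y) ^ (n + (d + 1))))
    fun n => by linear_combination (-y) ^ (d + 1) * hcoeff n (d + 1)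
  have hsum := hasSum_differences hprod hle hgt
  refine (hsum.mul_left (qPochInf (x * y) (x * y))).congr_fun fun d => ?_
  field_simp

end Transformations

section RogersRamanujan

theorem sum_antidiagonal_of_wz {M : Type*} [AddCommGroup M] {F G : ℕ → ℕ → M}
    (hFG : ∀ r n, F r (n + 1) - F r n = G (r + 1) n - G r (n + 1))
    (hG : ∀ n, G 0 (n + 1) = 0) (hF : ∀ r, F (r + 1) 0 = -G (r + 1) 0) (k : ℕ) :
    ∑ x ∈ antidiagonal k, F x.1 x.2 = F 0 0 := by
  induction k with
  | zero => simp
  | succ k ih =>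
    have hdiff : ∑ x ∈ antidiagonal k, F x.1 (x.2 + 1) - ∑ x ∈ antidiagonal k, F x.1 x.2 =
        ∑ x ∈ antidiagonal k, G (x.1 + 1) x.2 - ∑ x ∈ antidiagonal k, G x.1 (x.2 + 1) := by
      simp only [← Finset.sum_sub_distrib, hFG]
    have hG₁ := Finset.Nat.sum_antidiagonal_succ (n := k) (f := fun x => G x.1 x.2)
    have hG₂ := Finset.Nat.sum_antidiagonal_succ' (n := k) (f := fun x => G x.1 x.2)
    simp only [hG, zero_add] at hG₁
    rw [Finset.Nat.sum_antidiagonal_succ', hF, ← ih, sub_eq_iff_eq_add.1 hdiff, ← hG₁, hG₂]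
    abel

variable {q : ℂ}

/- The Bailey pair relative to `a = q` with `β_k = 1 / (q; q)_k`. -/
theorem sum_antidiagonal_eq_inv_qPoch (hq : ∀ n, q ^ (n + 1) ≠ 1) (k : ℕ) :
    ∑ x ∈ antidiagonal k, (-1) ^ x.1 * q ^ (3 * x.1.choose 2 + 2 * x.1) *
      (1 - q ^ (2 * x.1 + 1)) / (qPoch q q x.2 * qPoch q q (2 * x.1 + x.2 + 1)) =
    1 / qPoch q q k := by
  let F (r n : ℕ) : ℂ := qPoch q q (r + n) * ((-1) ^ r * q ^ (3 * r.choose 2 + 2 * r) *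
    (1 - q ^ (2 * r + 1)) / (qPoch q q n * qPoch q q (2 * r + n + 1)))
  -- The Wilf–Zeilberger companion of `F`; it is `0 / 0` at `(0, 0)`, where it is never evaluated.
  let G (r n : ℕ) : ℂ := -((-1) ^ r * q ^ (3 * r.choose 2 + 2 * r + n) * (1 - q ^ r) *
    qPoch q q (r + n) / ((1 - q ^ (r + n)) * (qPoch q q n * qPoch q q (2 * r + n))))
  have hne := qPoch_self_ne_zero hq
  have hfactor := one_sub_mul_pow_ne_zero hq
  have hwz (r n : ℕ) : F r (n + 1) - F r n = G (r + 1) n - G r (n + 1) := by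
    have h₁ := hne n
    have h₂ := hne (2 * r + n + 1)
    have h₃ := hfactor n
    have h₄ := hfactor (r + n)
    have h₅ := hfactor (2 * r + n + 1)
    simp only [F, G, ← add_assoc, mul_add_one, add_right_comm r 1 n, choose_two_succ,
      show 2 * r + 2 + n = 2 * r + n + 1 + 1 by ring, qPoch_succ _ _ n, qPoch_succ _ _ (r + n),
      qPoch_succ _ _ (2 * r + n + 1), pow_succ' q (r + n)]
    field_simp
    ring
  have hboundary (r : ℕ) : F (r + 1) 0 = -G (r + 1) 0 := by
    have h₁ := hne (2 * r + 2)
    have h₂ := hfactor r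
    have h₃ := hfactor (2 * r + 2)
    simp only [F, G, add_zero, mul_add_one, qPoch_succ _ _ (2 * r + 2), pow_succ' q r]
    field_simp
    ring
  have hzero : F 0 0 = 1 := by
    simpa [F, qPoch_zero, qPoch_succ] using div_self (hne 1)
  have hsum := (sum_antidiagonal_of_wz hwz (fun n => by simp [G]) hboundary k).trans hzero
  rw [eq_div_iff (hne k), mul_comm, Finset.mul_sum]
  refine (Finset.sum_congr rfl fun x hx => ?_).trans hsum
  rw [← Finset.HasAntidiagonal.mem_antidiagonal.1 hx]

theorem hasSum_rogersTheta (hq : ‖q‖ < 1) :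
    HasSum (fun r : ℕ => (q ^ 5) ^ r.choose 2 * (-q ^ 4) ^ r * (1 - q ^ (2 * r + 1)))
      (qPochInf (q ^ 5) (q ^ 5) * (qPochInf (q ^ 4) (q ^ 5) * qPochInf q (q ^ 5))) := by
  have hq5 := norm_pow_lt_one hq (n := 5) (by norm_num)
  have h := jacobi_triple_product (x := q ^ 4) (y := q) (by rwa [← pow_succ])
  rw [← pow_succ] at h
  refine h.congr_fun fun r => ?_
  rw [choose_two_succ, neg_pow (q ^ 4), neg_pow q]
  ring

theorem summable_durfee_pairs (hq : ‖q‖ < 1) {f : ℕ → ℂ} (hf : Summable fun r => ‖f r‖) :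
    Summable fun p : ℕ × ℕ => f p.1 * (q ^ (p.2 ^ 2 + p.2 * (2 * p.1 + 1)) /
      (qPoch q q p.2 * qPoch q q (p.2 + (2 * p.1 + 1)))) := by
  obtain ⟨C, hC⟩ := (tendsto_inv_qPoch hq hq).norm.bddAbove_range
  have hC' (n : ℕ) : ‖(qPoch q q n)⁻¹‖ ≤ C := hC ⟨n, rfl⟩
  refine .of_norm_bounded (hf.mul_of_nonneg ((summable_norm_rrR hq 1).mul_right C)
    (fun _ => norm_nonneg _) fun _ => mul_nonneg (norm_nonneg _) ((norm_nonneg _).trans (hC' 0)))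
    fun ⟨r, n⟩ => ?_
  have hpow : ‖q ^ (n * (2 * r + 1))‖ ≤ 1 :=
    norm_pow q _ ▸ pow_le_one₀ (norm_nonneg q) hq.le
  calc _ = ‖f r‖ * (‖q ^ n ^ 2 * 1 ^ n / qPoch q q n‖ *
        (‖q ^ (n * (2 * r + 1))‖ * ‖(qPoch q q (n + (2 * r + 1)))⁻¹‖)) := by
        simp only [← norm_mul]
        ring_nf
    _ ≤ ‖f r‖ * (‖q ^ n ^ 2 * 1 ^ n / qPoch q q n‖ * (1 * C)) := by
        gcongr
        exact hC' _
    _ = _ := by rw [one_mul]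

theorem hasSum_rrH (hq : ‖q‖ < 1) :
    HasSum (fun r : ℕ => (q ^ 5) ^ r.choose 2 * (-q ^ 4) ^ r * (1 - q ^ (2 * r + 1)) *
      (1 / qPochInf q q)) (rrH q) := by
  let θ : ℕ → ℂ := fun r => (q ^ 5) ^ r.choose 2 * (-q ^ 4) ^ r * (1 - q ^ (2 * r + 1))
  have hθ : Summable fun r => ‖θ r‖ := (hasSum_rogersTheta hq).summable.norm
  refine hasSum_fiber_of_hasSum_antidiagonal (summable_durfee_pairs hq hθ) ?_
    fun r => (hasSum_durfee hq (2 * r + 1)).mul_left (θ r)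
  refine (summable_norm_rrR hq q).of_norm.hasSum.congr_fun fun k => ?_
  rw [mul_div_assoc, div_eq_mul_one_div (q ^ k),
    ← sum_antidiagonal_eq_inv_qPoch (pow_succ_ne_one_of_norm_lt_one hq), Finset.mul_sum,
    Finset.mul_sum]
  refine Finset.sum_congr rfl fun x hx => ?_
  simp only [θ]
  rw [← Finset.HasAntidiagonal.mem_antidiagonal.1 hx, neg_pow (q ^ 4), add_sq, sq_eq_choose_two x.1,
    add_comm (2 * x.1) x.2, add_assoc x.2]
  ring

theorem qPoch_five_mul (q : ℂ) (n : ℕ) :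
    qPoch q q (5 * n) = qPoch (q ^ 5) (q ^ 5) n *
      (qPoch (q ^ 4) (q ^ 5) n * qPoch q (q ^ 5) n) *
      (qPoch (q ^ 2) (q ^ 5) n * qPoch (q ^ 3) (q ^ 5) n) := by
  induction n with
  | zero => simp only [mul_zero, qPoch_zero, mul_one]
  | succ n ih =>
    simp only [mul_add_one, qPoch_succ _ _ (5 * n + _), qPoch_succ, ih]
    ring

theorem qPochInf_eq_prod_five (hq : ‖q‖ < 1) :
    qPochInf q q = qPochInf (q ^ 5) (q ^ 5) *
      (qPochInf (q ^ 4) (q ^ 5) * qPochInf q (q ^ 5)) *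
      (qPochInf (q ^ 2) (q ^ 5) * qPochInf (q ^ 3) (q ^ 5)) := by
  have hlim (a : ℂ) := tendsto_qPoch a (norm_pow_lt_one hq (n := 5) (by norm_num))
  have hsub : Tendsto (fun n => qPoch q q (5 * n)) atTop (𝓝 (qPochInf q q)) :=
    (tendsto_qPoch q hq).comp (tendsto_id.const_mul_atTop' (by norm_num))
  simp only [qPoch_five_mul] at hsub
  exact tendsto_nhds_unique hsub
    (((hlim _).mul ((hlim _).mul (hlim _))).mul ((hlim _).mul (hlim _)))

theorem rrH_eq (hq : ‖q‖ < 1) :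
    rrH q = 1 / (qPochInf (q ^ 2) (q ^ 5) * qPochInf (q ^ 3) (q ^ 5)) := by
  have h := (hasSum_rrH hq).unique ((hasSum_rogersTheta hq).mul_right _)
  have hne := qPochInf_ne_zero hq hq
  rw [qPochInf_eq_prod_five hq] at h hne
  have hθ := left_ne_zero_of_mul hne
  rw [h, mul_one_div, div_mul_cancel_left₀ hθ, one_div]

end RogersRamanujan

section Series

theorem qPoch_pow_four_mul_qPoch_neg (q : ℂ) (k : ℕ) :
    qPoch (q ^ 4) (q ^ 4) k * qPoch (-q) (q ^ 2) k =
      qPoch (q ^ 2) (q ^ 2) k * qPoch (-q) q (2 * k) := by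
  induction k with
  | zero => simp only [mul_zero, qPoch_zero]
  | succ k ih =>
    simp only [mul_add_one, qPoch_succ]
    linear_combination (1 - q ^ 4 * (q ^ 4) ^ k) * (1 - -q * (q ^ 2) ^ k) * ih

theorem qPoch_pow_four_mul_qPoch_neg_succ (q : ℂ) (k : ℕ) :
    qPoch (q ^ 4) (q ^ 4) k * qPoch (-q) (q ^ 2) (k + 1) =
      qPoch (q ^ 2) (q ^ 2) k * qPoch (-q) q (2 * k + 1) := by
  rw [qPoch_succ, qPoch_succ, ← mul_assoc, qPoch_pow_four_mul_qPoch_neg]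
  ring

variable {q : ℂ}

theorem hasSum_rrH_qPoch_neg_succ (hq : ‖q‖ < 1) :
    HasSum (fun k : ℕ => qPochInf (-q) q * ((-1) ^ k * q ^ (k * (3 * k + 2)) /
      (qPoch (q ^ 4) (q ^ 4) k * qPoch (-q) (q ^ 2) (k + 1)))) (rrH q) := by
  refine (hasSum_rrR_even hq q).congr_fun fun k => ?_
  have hne := qPoch_ne_zero (a := -q) (by rwa [norm_neg]) hq (2 * k + 1)
  rw [qPoch_pow_four_mul_qPoch_neg_succ, ← qPoch_mul_qPochInf (-q) hq (2 * k + 1), neg_mul]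
  field_simp
  ring

theorem summable_one_sub_pow_mul_qPoch_neg (hq : ‖q‖ < 1) :
    Summable fun k : ℕ => (1 - q ^ (4 * k)) * ((-1) ^ k * q ^ (6 * k.choose 2 + k) /
      (qPoch (q ^ 4) (q ^ 4) k * qPoch (-q) (q ^ 2) k)) := by
  have hq4 := norm_pow_lt_one hq (n := 4) (by norm_num)
  have hcoeff : Tendsto (fun k => (1 - (q ^ 4) ^ k) *
      ((qPoch (q ^ 4) (q ^ 4) k)⁻¹ * (qPoch (-q) (q ^ 2) k)⁻¹)) atTop (𝓝 _) :=
    ((tendsto_pow_atTop_nhds_zero_of_norm_lt_one hq4).const_sub 1).mul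
      ((tendsto_inv_qPoch hq4 hq4).mul
        (tendsto_inv_qPoch (by rwa [norm_neg]) (norm_pow_lt_one hq two_ne_zero)))
  refine (summable_norm_pow_choose_two_mul (norm_pow_lt_one hq (n := 6) (by norm_num)) (-q)
    (hcoeff.isBigO_one ℝ)).of_norm.congr fun k => ?_
  rw [neg_pow]
  ring

theorem hasSum_rrH_qPoch_neg (hq : ‖q‖ < 1) :
    HasSum (fun k : ℕ => qPochInf (-q) q * ((-1) ^ k * q ^ (6 * k.choose 2 + k) /
      (qPoch (q ^ 4) (q ^ 4) k * qPoch (-q) (q ^ 2) k))) (rrH q) := by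
  -- With `b k` the present summand, `b k` minus the one of `hasSum_rrH_qPoch_neg_succ` is
  -- `u k - u (k + 1)` for `u k = (1 - q ^ (4 * k)) * b k`.
  refine hasSum_of_eq_add_telescope (hasSum_rrH_qPoch_neg_succ hq)
    ((summable_one_sub_pow_mul_qPoch_neg hq).mul_left (qPochInf (-q) q)) (by simp) fun k => ?_
  have hq2 := norm_pow_lt_one hq two_ne_zero
  have hq4 := norm_pow_lt_one hq (n := 4) (by norm_num)
  have hpoch₁ := qPoch_ne_zero hq4 hq4 (k + 1)
  have hpoch₂ := qPoch_ne_zero (a := -q) (by rwa [norm_neg]) hq2 (k + 1)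
  rw [qPoch_succ] at hpoch₁
  rw [qPoch_succ, neg_mul, sub_neg_eq_add] at hpoch₂
  obtain ⟨_, _⟩ := mul_ne_zero_iff.1 hpoch₁
  obtain ⟨_, _⟩ := mul_ne_zero_iff.1 hpoch₂
  have hpow : k * (3 * k + 2) = 6 * k.choose 2 + k + 4 * k := by
    linarith [sq_eq_choose_two k]
  rw [hpow, choose_two_succ, qPoch_succ, qPoch_succ, neg_mul, sub_neg_eq_add]
  field_simp
  ring

theorem hasSum_rrH_sq {p : ℂ} (hp : ‖p‖ < 1) :
    HasSum (fun k : ℕ => qPochInf p (p ^ 2) * (p ^ (3 * k.choose 2 + 4 * k) /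
      (qPoch p p k * qPoch p (p ^ 2) (k + 2)))) (rrH (p ^ 2)) := by
  have hp2 := norm_pow_lt_one hp two_ne_zero
  refine (hasSum_rrR_sq hp (p ^ 2)).congr_fun fun k => ?_
  have hne := qPoch_ne_zero hp hp2 (k + 2)
  rw [← qPoch_mul_qPochInf p hp2 (k + 2),
    show p ^ 2 * p ^ (2 * k + 3) = p * (p ^ 2) ^ (k + 2) by ring]
  field_simp
  ring

theorem exists_hasSum_of_hasSum_mul {ι K : Type*} [Field K] [TopologicalSpace K]
    [IsTopologicalSemiring K] {f : ι → K} {P H Z : K} (hP : P ≠ 0)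
    (h : HasSum (fun k => P * f k) H) (hH : H = 1 / Z) :
    ∃ S, HasSum f S ∧ H = P * S ∧ S = 1 / (P * Z) :=
  ⟨H / P, by simpa only [mul_div_cancel_left₀ _ hP] using h.div_const P,
    (mul_div_cancel₀ H hP).symm, by rw [hH, div_div, mul_comm]⟩

end Series

theorem mainTheorem6 (q r : ℂ) (hq : ‖q‖ < 1) (hr : r ^ 4 = q) :
    -- `r` is a fourth root `q^{1/4}`, and `r ^ 2` is the corresponding `q^{1/2}`
    -- the series `H(q)` converges, and its product formula
    Summable (fun k : ℕ => q ^ (k ^ 2) * q ^ k / qPoch q q k) ∧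
    rrH q = 1 / (qPochInf (q ^ 2) (q ^ 5) * qPochInf (q ^ 3) (q ^ 5)) ∧
    -- the series with `q^{k(3k+5)/4}`
    (∃ S : ℂ,
      HasSum (fun k : ℕ => r ^ (k * (3 * k + 5)) /
        (qPoch (r ^ 2) (r ^ 2) k * qPoch (r ^ 2) q (k + 2))) S ∧
      rrH q = qPochInf (r ^ 2) q * S ∧
      S = 1 / (qPochInf (r ^ 2) q *
        (qPochInf (q ^ 2) (q ^ 5) * qPochInf (q ^ 3) (q ^ 5)))) ∧
    -- the series with `q^{k(3k+2)}`
    (∃ S : ℂ,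
      HasSum (fun k : ℕ => (-1) ^ k * q ^ (k * (3 * k + 2)) /
        (qPoch (q ^ 4) (q ^ 4) k * qPoch (-q) (q ^ 2) (k + 1))) S ∧
      rrH q = qPochInf (-q) q * S ∧
      S = 1 / (qPochInf (-q) q *
        (qPochInf (q ^ 2) (q ^ 5) * qPochInf (q ^ 3) (q ^ 5)))) ∧
    -- the series with `q^{k(3k-2)}`
    (∃ S : ℂ,
      HasSum (fun k : ℕ => (-1) ^ k * q ^ ((k : ℤ) * (3 * (k : ℤ) - 2)) /
        (qPoch (q ^ 4) (q ^ 4) k * qPoch (-q) (q ^ 2) k)) S ∧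
      rrH q = qPochInf (-q) q * S ∧
      S = 1 / (qPochInf (-q) q *
        (qPochInf (q ^ 2) (q ^ 5) * qPochInf (q ^ 3) (q ^ 5)))) := by
  have hp : ‖r ^ 2‖ < 1 := norm_pow_lt_one
    ((pow_lt_one_iff_of_nonneg (norm_nonneg r) four_ne_zero).1 (by rwa [← norm_pow, hr]))
    two_ne_zero
  have hneg : qPochInf (-q) q ≠ 0 := qPochInf_ne_zero (by rwa [norm_neg]) hq
  refine ⟨(summable_norm_rrR hq q).of_norm, rrH_eq hq,
    exists_hasSum_of_hasSum_mul (qPochInf_ne_zero hp hq) ?_ (rrH_eq hq),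
    exists_hasSum_of_hasSum_mul hneg (hasSum_rrH_qPoch_neg_succ hq) (rrH_eq hq),
    exists_hasSum_of_hasSum_mul hneg ((hasSum_rrH_qPoch_neg hq).congr_fun fun k => ?_)
      (rrH_eq hq)⟩
  · have hsq : (r ^ 2) ^ 2 = q := by rw [← pow_mul, hr]
    refine (hsq ▸ hasSum_rrH_sq hp).congr_fun fun k => ?_
    rw [← pow_mul, show k * (3 * k + 5) = 2 * (3 * k.choose 2 + 4 * k) by
      linarith [sq_eq_choose_two k]]
  · rw [show (k : ℤ) * (3 * k - 2) = (6 * k.choose 2 + k : ℕ) by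
      have := sq_eq_choose_two k
      push_cast
      zify at this
      linarith, zpow_natCast]
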